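/- Let $A$ be a quantum system whose Hilbert space $\mathcal{H}_A$ is a separable complex Hilbert space (of finite or infinite dimension). Let $\mathbf{Obs}(A)$ be the set of bounded self-adjoint operators on $\mathcal{H}_A$, and let $\mathfrak{D}(A)$ be the set of density operators, i.e. positive trace class operators $\rho$ on $\mathcal{H}_A$ with $\mathrm{Tr}[\rho]=1$. A positive operator-valued measure (POVM) on a measurable space $(X,\Sigma_X)$ is a function $\mu:\Sigma_X\to\mathbf{Obs}(A)$ such that $\mu(E)\ge 0$ for all $E\in\Sigma_X$, $\mu(X)=\mathbb{1}$, and $\mu\left(\bigsqcup_{n=1}^\infty E_n\right)=\sum_{n=1}^\infty\mu(E_n)$ for all pairwise disjoint $E_1,E_2,\ldots\in\Sigma_X$, with convergence in the weak operator topology. Let $\mathfrak{Meas}$ be the category of measurable spaces and measurable functions. Let $\mathbf{M}:\mathfrak{Meas}\to\mathfrak{Set}$ be the functor that sends $(X,\Sigma_X)$ to the set of POVMs $\mu:\Sigma_X\to\mathbf{Obs}(A)$, and let $\mathbf{P}:\mathfrak{Meas}\to\mathfrak{Set}$ be the functor that sends $(X,\Sigma_X)$ to the set of probability measures on it; both send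 a measurable function $f:X\to Y$ to the pushforward $\mu\mapsto f_*\mu$, where $(f_*\mu)(F)=\mu(f^{-1}(F))$. For $\rho\in\mathfrak{D}(A)$ let $\rho_*:\mathbf{M}\to\mathbf{P}$ be the natural transformation given by the Born rule, i.e. whose component at $(X,\Sigma_X)$ sends a POVM $\mu$ to the probability measure $E\mapsto\mathrm{Tr}[\mu(E)\rho]$. Then the map $\rho\mapsto\rho_*$ is a bijection from $\mathfrak{D}(A)$ to the set of all natural transformations $\mathbf{M}\to\mathbf{P}$. -/

import Mathlib

open CategoryTheory MeasureTheory

universe u v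

noncomputable section

namespace BornRule

section Operators

variable {H : Type v} [NormedAddCommGroup H] [InnerProductSpace ℂ H] [CompleteSpace H]

/-- The self-adjoint (bounded) operators on `H`. -/
abbrev Obs (H : Type v) [NormedAddCommGroup H] [InnerProductSpace ℂ H] [CompleteSpace H] :
    Type v :=
  selfAdjoint (H →L[ℂ] H)

/-- The index set of a fixed Hilbert basis (orthonormal basis) of `H`. -/
def basisIndex (H : Type v) [NormedAddCommGroup H] [InnerProductSpace ℂ H] [CompleteSpace H] :
    Set H :=
  (exists_hilbertBasis ℂ H).choose

/-- A fixed Hilbert basis (orthonormal basis) of `H`. -/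
def stdBasis (H : Type v) [NormedAddCommGroup H] [InnerProductSpace ℂ H] [CompleteSpace H] :
    HilbertBasis (basisIndex H) ℂ H :=
  (exists_hilbertBasis ℂ H).choose_spec.choose

/-- `T` is trace class: `∑ ⟪eᵢ, |T| eᵢ⟫ < ∞` for an orthonormal basis `e`,
where `|T| = √(T* T)`. -/
def IsTraceClass (T : H →L[ℂ] H) : Prop :=
  Summable fun i => inner ℂ (stdBasis H i) (CFC.abs T (stdBasis H i))

/-- The trace `∑ ⟪eᵢ, T eᵢ⟫` of a trace class operator. See `DensityOperator.hasSum_trace_mul` for its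
independence of the basis. -/
def trace (T : H →L[ℂ] H) : ℂ :=
  ∑' i, inner ℂ (stdBasis H i) (T (stdBasis H i))

/-- Density operators: positive trace class operators of unit trace. -/
structure DensityOperator (H : Type v) [NormedAddCommGroup H] [InnerProductSpace ℂ H]
    [CompleteSpace H] where
  /-- The underlying operator. -/
  op : H →L[ℂ] H
  nonneg : 0 ≤ op
  traceClass : IsTraceClass op
  trace_eq_one : trace op = 1

theorem hasSum_norm_inner_sq {H ι : Type*} [NormedAddCommGroup H] [InnerProductSpace ℂ H]
    (b : HilbertBasis ι ℂ H) (x : H) :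
    HasSum (fun i => ‖inner ℂ (b i) x‖ ^ 2) (‖x‖ ^ 2) := by
  have h := Complex.reCLM.hasSum (b.hasSum_inner_mul_inner x x)
  have h2 : Complex.reCLM (inner ℂ x x) = ‖x‖ ^ 2 := by
    simpa using inner_self_eq_norm_sq (𝕜 := ℂ) x
  rw [h2] at h
  refine h.congr_fun fun i => ?_
  have h3 : inner ℂ x (b i) * inner ℂ (b i) x = ((‖inner ℂ (b i) x‖ ^ 2 : ℝ) : ℂ) := by
    rw [← inner_conj_symm x (b i), Complex.conj_mul']
    push_cast
    rfl
  simp [h3, -Complex.ofReal_pow]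

theorem summable_norm_inner_sq {H ι κ : Type*} [NormedAddCommGroup H] [InnerProductSpace ℂ H]
    (b : HilbertBasis ι ℂ H) (T : H →L[ℂ] H) (v : κ → H) (h : Summable fun j => ‖v j‖ ^ 2) :
    Summable fun p : κ × ι => ‖inner ℂ (b p.2) (T (v p.1))‖ ^ 2 := by
  have h1 (j : κ) : HasSum (fun i => ‖inner ℂ (b i) (T (v j))‖ ^ 2) (‖T (v j)‖ ^ 2) :=
    hasSum_norm_inner_sq b (T (v j))
  refine (summable_prod_of_nonneg fun _ => sq_nonneg _).2 ⟨fun j => (h1 j).summable, ?_⟩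
  simp only [fun j => (h1 j).tsum_eq]
  refine Summable.of_nonneg_of_le (fun _ => by positivity) (fun j => ?_) (h.mul_left (‖T‖ ^ 2))
  rw [← mul_pow]
  gcongr
  exact T.le_opNorm _

namespace DensityOperator

variable (ρ : DensityOperator H)

/-- The square root of a density operator. -/
def sqrt : H →L[ℂ] H := CFC.sqrt ρ.op

theorem inner_sqrt (x y : H) : inner ℂ (ρ.sqrt x) y = inner ℂ x (ρ.sqrt y) := by
  have h : (0 : H →L[ℂ] H) ≤ ρ.sqrt := CFC.sqrt_nonneg _
  exact ((ContinuousLinearMap.nonneg_iff_isPositive _).1 h).inner_left_eq_inner_right x y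

theorem sqrt_sqrt (x : H) : ρ.sqrt (ρ.sqrt x) = ρ.op x := by
  have h := CFC.sqrt_mul_sqrt_self ρ.op ρ.nonneg
  exact congrArg (fun T : H →L[ℂ] H => T x) h

theorem summable_std : Summable fun i => ‖ρ.sqrt (stdBasis H i)‖ ^ 2 := by
  have h := ρ.traceClass
  rw [IsTraceClass, CFC.abs_of_nonneg _ ρ.nonneg] at h
  have h1 := Complex.reCLM.summable h
  refine h1.congr fun i => ?_
  rw [← ρ.sqrt_sqrt, ← ρ.inner_sqrt]
  simpa using inner_self_eq_norm_sq (𝕜 := ℂ) (ρ.sqrt (stdBasis H i))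

theorem summable_basis {ι : Type*} (b : HilbertBasis ι ℂ H) :
    Summable fun i => ‖ρ.sqrt (b i)‖ ^ 2 := by
  have h := (summable_norm_inner_sq b (1 : H →L[ℂ] H) _ ρ.summable_std).prod_symm
  refine ((summable_prod_of_nonneg fun _ => sq_nonneg _).1 h).2.congr fun i => ?_
  rw [← (hasSum_norm_inner_sq (stdBasis H) (ρ.sqrt (b i))).tsum_eq]
  refine tsum_congr fun j => ?_
  rw [← ρ.inner_sqrt, ← inner_conj_symm, RCLike.norm_conj]
  rfl

/-- For a density operator `ρ` and a bounded operator `M`, the trace of `M ρ` computed in the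
basis `b` agrees with the trace of `√ρ M √ρ` computed in the basis `c`. -/
theorem exists_hasSum {ι κ : Type*} (b : HilbertBasis ι ℂ H) (c : HilbertBasis κ ℂ H)
    (M : H →L[ℂ] H) :
    ∃ L : ℂ, HasSum (fun i => inner ℂ (b i) ((M * ρ.op) (b i))) L ∧
      HasSum (fun j => inner ℂ (ρ.sqrt (c j)) (M (ρ.sqrt (c j)))) L := by
  let f : κ × ι → ℂ := fun p =>
    inner ℂ (b p.2) (M (ρ.sqrt (c p.1))) * inner ℂ (c p.1) (ρ.sqrt (b p.2))
  have h1 := summable_norm_inner_sq b M _ (ρ.summable_basis c)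
  have h2 := (summable_norm_inner_sq c (1 : H →L[ℂ] H) _ (ρ.summable_basis b)).prod_symm
  have hf : Summable f := by
    refine Summable.of_norm_bounded (h1.add h2) fun p => ?_
    have h3 : ‖f p‖ = ‖inner ℂ (b p.2) (M (ρ.sqrt (c p.1)))‖ *
        ‖inner ℂ (c p.1) (ρ.sqrt (b p.2))‖ := norm_mul _ _
    rw [h3]
    have h4 : inner ℂ (c p.swap.2) ((1 : H →L[ℂ] H) (ρ.sqrt (b p.swap.1))) =
        inner ℂ (c p.1) (ρ.sqrt (b p.2)) := rfl
    rw [h4]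
    nlinarith [sq_nonneg (‖inner ℂ (b p.2) (M (ρ.sqrt (c p.1)))‖ -
      ‖inner ℂ (c p.1) (ρ.sqrt (b p.2))‖),
      sq_nonneg (‖inner ℂ (b p.2) (M (ρ.sqrt (c p.1)))‖),
      sq_nonneg (‖inner ℂ (c p.1) (ρ.sqrt (b p.2))‖)]
  refine ⟨∑' p, f p, ?_, ?_⟩
  · refine HasSum.prod_fiberwise (f := fun p : ι × κ => f p.swap)
      ((Equiv.prodComm ι κ).hasSum_iff.2 hf.hasSum) fun i => ?_
    have h := c.hasSum_inner_mul_inner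
      (ContinuousLinearMap.adjoint ρ.sqrt (ContinuousLinearMap.adjoint M (b i))) (ρ.sqrt (b i))
    have e : inner ℂ (ContinuousLinearMap.adjoint ρ.sqrt (ContinuousLinearMap.adjoint M (b i)))
        (ρ.sqrt (b i)) = inner ℂ (b i) ((M * ρ.op) (b i)) := by
      rw [ContinuousLinearMap.adjoint_inner_left, ContinuousLinearMap.adjoint_inner_left,
        ρ.sqrt_sqrt]
      rfl
    rw [e] at h
    refine h.congr_fun fun j => ?_
    have h5 : f (j, i) = inner ℂ (b i) (M (ρ.sqrt (c j))) * inner ℂ (c j) (ρ.sqrt (b i)) := rfl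
    rw [ContinuousLinearMap.adjoint_inner_left, ContinuousLinearMap.adjoint_inner_left]
    exact h5
  · refine HasSum.prod_fiberwise hf.hasSum fun j => ?_
    have h := b.hasSum_inner_mul_inner (ρ.sqrt (c j)) (M (ρ.sqrt (c j)))
    refine h.congr_fun fun i => ?_
    have h5 : f (j, i) = inner ℂ (b i) (M (ρ.sqrt (c j))) * inner ℂ (c j) (ρ.sqrt (b i)) := rfl
    rw [h5, ρ.inner_sqrt, mul_comm]

/-- The trace of `M ρ`, with `ρ` a density operator and `M` bounded, can be computed in any
orthonormal basis. -/
theorem hasSum_trace_mul {ι : Type*} (b : HilbertBasis ι ℂ H) (M : H →L[ℂ] H) :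
    HasSum (fun i => inner ℂ (b i) ((M * ρ.op) (b i))) (trace (M * ρ.op)) := by
  obtain ⟨L, h1, h2⟩ := ρ.exists_hasSum b (stdBasis H) M
  obtain ⟨L', h3, h4⟩ := ρ.exists_hasSum (stdBasis H) (stdBasis H) M
  have h5 : trace (M * ρ.op) = L' := h3.tsum_eq
  rw [h5, ← h2.unique h4]
  exact h1

theorem hasSum_trace_mul' (M : H →L[ℂ] H) :
    HasSum (fun i => inner ℂ (ρ.sqrt (stdBasis H i)) (M (ρ.sqrt (stdBasis H i))))
      (trace (M * ρ.op)) := by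
  obtain ⟨L, h1, h2⟩ := ρ.exists_hasSum (stdBasis H) (stdBasis H) M
  rwa [(ρ.hasSum_trace_mul _ M).unique h1]

theorem trace_mul_nonneg {M : H →L[ℂ] H} (hM : 0 ≤ M) :
    0 ≤ (trace (M * ρ.op)).re ∧ (trace (M * ρ.op)).im = 0 := by
  have hP := (ContinuousLinearMap.nonneg_iff_isPositive _).1 hM
  have h := ρ.hasSum_trace_mul' M
  refine ⟨(Complex.reCLM.hasSum h).nonneg fun _ => hP.re_inner_nonneg_right _, ?_⟩
  refine (Complex.imCLM.hasSum h).unique (hasSum_zero.congr_fun fun i => ?_)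
  have h1 := inner_conj_symm (𝕜 := ℂ) (ρ.sqrt (stdBasis H i)) (M (ρ.sqrt (stdBasis H i)))
  rw [hP.inner_left_eq_inner_right] at h1
  exact Complex.conj_eq_iff_im.1 h1

theorem hasSum_trace {M : ℕ → H →L[ℂ] H} {N : H →L[ℂ] H} (hM : ∀ n, 0 ≤ M n)
    (h : ∀ x y, HasSum (fun n => inner ℂ x (M n y)) (inner ℂ x (N y))) :
    HasSum (fun n => (trace (M n * ρ.op)).re) (trace (N * ρ.op)).re := by
  let v : basisIndex H → H := fun j => ρ.sqrt (stdBasis H j)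
  let f : basisIndex H × ℕ → ℝ := fun p => (inner ℂ (v p.1) (M p.2 (v p.1))).re
  have hf0 : 0 ≤ f := fun p =>
    ((ContinuousLinearMap.nonneg_iff_isPositive _).1 (hM p.2)).re_inner_nonneg_right (v p.1)
  have h1 (j) : HasSum (fun n => f (j, n)) (inner ℂ (v j) (N (v j))).re :=
    Complex.reCLM.hasSum (h (v j) (v j))
  have h2 : HasSum (fun j => (inner ℂ (v j) (N (v j))).re) (trace (N * ρ.op)).re :=
    Complex.reCLM.hasSum (ρ.hasSum_trace_mul' N)
  have hf : Summable f := by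
    refine (summable_prod_of_nonneg hf0).2 ⟨fun j => (h1 j).summable, ?_⟩
    simp only [fun j => (h1 j).tsum_eq]
    exact h2.summable
  have h3 : HasSum f (trace (N * ρ.op)).re := by
    rw [← (hf.hasSum.prod_fiberwise h1).unique h2]
    exact hf.hasSum
  refine HasSum.prod_fiberwise (f := fun p : ℕ × basisIndex H => f p.swap)
    ((Equiv.prodComm _ _).hasSum_iff.2 h3) fun n => ?_
  exact Complex.reCLM.hasSum (ρ.hasSum_trace_mul' (M n))

end DensityOperator

/-- Positive operator-valued measures on `X`: functions `μ` from the σ-algebra of `X` to the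
self-adjoint operators on `H` with `μ E ≥ 0`, `μ X = 1`, and `μ (⋃ Eₙ) = ∑ μ Eₙ` for disjoint
events `Eₙ`, where the series converges in the weak operator topology. -/
@[ext]
structure POVM (H : Type v) [NormedAddCommGroup H] [InnerProductSpace ℂ H] [CompleteSpace H]
    (X : Type u) [MeasurableSpace X] where
  /-- The operator assigned to an event. -/
  toFun : {E : Set X // MeasurableSet E} → Obs H
  nonneg : ∀ E, (0 : H →L[ℂ] H) ≤ toFun E
  univ : (toFun ⟨Set.univ, MeasurableSet.univ⟩ : H →L[ℂ] H) = 1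
  hasSum_iUnion : ∀ E : ℕ → {E : Set X // MeasurableSet E},
    (Pairwise fun m n => Disjoint (E m : Set X) (E n : Set X)) →
    ∀ x y : H, HasSum (fun n => inner ℂ x ((toFun (E n) : H →L[ℂ] H) y))
      (inner ℂ x ((toFun ⟨⋃ n, E n, MeasurableSet.iUnion fun n => (E n).2⟩ : H →L[ℂ] H) y))

namespace POVM

variable {X Y : Type u} [MeasurableSpace X] [MeasurableSpace Y]

/-- The pushforward `F ↦ μ (f ⁻¹ F)` of a POVM along a measurable function. -/
def map (f : X → Y) (hf : Measurable f) (μ : POVM H X) : POVM H Y where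
  toFun F := μ.toFun ⟨f ⁻¹' F, hf F.2⟩
  nonneg F := μ.nonneg _
  univ := μ.univ
  hasSum_iUnion E hE x y := by
    have h := μ.hasSum_iUnion (fun n => ⟨f ⁻¹' (E n), hf (E n).2⟩)
      (fun m n hmn => (hE hmn).preimage f) x y
    simpa only [Set.preimage_iUnion] using h

theorem empty (μ : POVM H X) : (μ.toFun ⟨∅, MeasurableSet.empty⟩ : H →L[ℂ] H) = 0 := by
  refine ContinuousLinearMap.ext fun y => ext_inner_left ℂ fun x => ?_
  have h := μ.hasSum_iUnion (fun _ => ⟨∅, MeasurableSet.empty⟩) (fun _ _ _ => by simp) x y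
  have h1 := tendsto_nhds_unique h.summable.tendsto_atTop_zero tendsto_const_nhds
  simpa using h1.symm

end POVM

/-- The measure `E ↦ Tr[μ(E) ρ]`. -/
def bornMeasure (ρ : DensityOperator H) {X : Type u} [MeasurableSpace X] (μ : POVM H X) :
    Measure X :=
  Measure.ofMeasurable
    (fun E hE => ENNReal.ofReal (trace ((μ.toFun ⟨E, hE⟩ : H →L[ℂ] H) * ρ.op)).re)
    (by rw [μ.empty]; simp [trace])
    (fun E hE hd => by
      have h := ρ.hasSum_trace (fun n => μ.nonneg ⟨E n, hE n⟩)
        (μ.hasSum_iUnion (fun n => ⟨E n, hE n⟩) hd)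
      rw [← h.tsum_eq]
      exact ENNReal.ofReal_tsum_of_nonneg
        (fun n => (ρ.trace_mul_nonneg (μ.nonneg _)).1) h.summable)

theorem bornMeasure_apply (ρ : DensityOperator H) {X : Type u} [MeasurableSpace X]
    (μ : POVM H X) {E : Set X} (hE : MeasurableSet E) :
    bornMeasure ρ μ E = ENNReal.ofReal (trace ((μ.toFun ⟨E, hE⟩ : H →L[ℂ] H) * ρ.op)).re := by
  rw [bornMeasure, Measure.ofMeasurable_apply E hE]

/-- The Born rule: the probability measure `E ↦ Tr[μ(E) ρ]`. -/
def born (ρ : DensityOperator H) {X : Type u} [MeasurableSpace X] (μ : POVM H X) :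
    ProbabilityMeasure X :=
  ⟨bornMeasure ρ μ, ⟨by
    rw [bornMeasure_apply ρ μ MeasurableSet.univ, μ.univ, one_mul, ρ.trace_eq_one]
    simp⟩⟩

/-- The defining property of `born`: the probability of the event `E` is `Tr[μ(E) ρ]`. -/
theorem born_apply (ρ : DensityOperator H) {X : Type u} [MeasurableSpace X] (μ : POVM H X)
    (E : {E : Set X // MeasurableSet E}) :
    (((born ρ μ : Measure X).real E : ℝ) : ℂ) = trace ((μ.toFun E : H →L[ℂ] H) * ρ.op) := by
  have h0 := ρ.trace_mul_nonneg (μ.nonneg E)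
  have h1 : (born ρ μ : Measure X) E =
      ENNReal.ofReal (trace ((μ.toFun E : H →L[ℂ] H) * ρ.op)).re :=
    bornMeasure_apply ρ μ E.2
  rw [Measure.real, h1, ENNReal.toReal_ofReal h0.1]
  exact Complex.ext rfl h0.2.symm

end Operators

section Functors

/-- The measurement functor: it sends a measurable space to the set of its `H`-valued POVMs and
a measurable function to the pushforward of POVMs. -/
def measurementFunctor (H : Type u) [NormedAddCommGroup H] [InnerProductSpace ℂ H]
    [CompleteSpace H] : MeasCat.{u} ⥤ Type u where
  obj X := POVM H X
  map f := TypeCat.ofHom (POVM.map f.1 f.2)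
  map_id _ := rfl
  map_comp _ _ := rfl

/-- The probability functor: it sends a measurable space to the set of its probability measures
and a measurable function to the pushforward of probability measures. -/
def probabilityFunctor : MeasCat.{u} ⥤ Type u where
  obj X := ProbabilityMeasure X
  map f := TypeCat.ofHom fun μ => μ.map f.2.aemeasurable
  map_id X := by
    refine ConcreteCategory.hom_ext _ _ fun (μ : ProbabilityMeasure X) => ?_
    have h : μ.map (f := id) measurable_id.aemeasurable = μ := Subtype.ext Measure.map_id
    exact h
  map_comp {X _ _} f g := by
    refine ConcreteCategory.hom_ext _ _ fun (μ : ProbabilityMeasure X) => ?_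
    have h : μ.map (g.2.comp f.2).aemeasurable =
        (μ.map f.2.aemeasurable).map g.2.aemeasurable :=
      Subtype.ext (Measure.map_map g.2 f.2).symm
    exact h

/-- The natural transformation `ρ_*` induced by a density operator through the Born rule. -/
def bornNatTrans {H : Type u} [NormedAddCommGroup H] [InnerProductSpace ℂ H] [CompleteSpace H]
    (ρ : DensityOperator H) : measurementFunctor H ⟶ probabilityFunctor.{u} where
  app X := TypeCat.ofHom fun μ : POVM H X => born ρ μ
  naturality X Y f := by
    refine ConcreteCategory.hom_ext _ _ fun (μ : POVM H X) => ?_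
    refine Subtype.ext (Measure.ext fun F hF => ?_)
    have h1 : (born ρ (POVM.map f.1 f.2 μ) : Measure Y) F = (born ρ μ : Measure X) (f.1 ⁻¹' F) :=
      (bornMeasure_apply ρ _ hF).trans (bornMeasure_apply ρ μ (f.2 hF)).symm
    exact h1.trans (Measure.map_apply f.2 hF).symm

end Functors

end BornRule

end

/-!
Call `M` with `0 ≤ M ≤ 1` an effect. A natural transformation `η` is the same thing as a
probability assignment on effects: by naturality along the indicator of an event `E`, the
probability `η(μ)(E)` depends only on the effect `μ(E)` (`component_apply`). This assignment `v`
is nonnegative, normalized and additive, as one sees on three-outcome POVMs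
(`isEffectAdditive_effectProb`), so the proof is Busch's version of Gleason's theorem.

Additivity and positivity force `v` to be homogeneous for scalars in `[0, 1]`, and rescaling a
self-adjoint `a` to the effect `(1 + a / c) / 2` extends `v` to a bounded complex linear functional
`L` on all operators (`IsEffectAdditive.exists_strongDual`). The bounded sesquilinear form
`(x, y) ↦ L(|y⟩⟨x|)` is represented by a positive operator `ρ`, so that `v(|x⟩⟨x|) = ⟨ρ x, x⟩`.

Rank-one effects suffice because of normality. For an effect `M` and an orthonormal basis `b`,
countable by separability, there is a POVM on `Option ι` with outcomes `√M |bᵢ⟩⟨bᵢ| √M` and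
`1 - M`; the σ-additivity of its probability measure gives
`v(M) = ∑ v(|√M bᵢ⟩⟨√M bᵢ|)` (`hasSum_effectProb`). Taking `M = 1` shows that `ρ` has trace one, and
for general `M` the identity shows that natural transformations agreeing on rank-one effects are
equal (`natTrans_ext_rankOne`), which applies to `η` and `ρ_*`. Injectivity holds because
`ρ_*` recovers the quadratic form of `ρ` on the unit ball.
-/

noncomputable section

namespace BornRule

/-! ### Additive functions on the effects of a C⋆-algebra -/

section Shift

variable {A : Type*} [CStarAlgebra A]

/-- The effect `(1 + a / c) / 2` attached to a self-adjoint `a` with `-c ≤ a ≤ c`. -/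
def shift (c : ℝ) (a : A) : A := (2⁻¹ : ℝ) • (1 + c⁻¹ • a)

theorem shift_add {c : ℝ} (a b : A) :
    shift (2 * c) (a + b) = (2⁻¹ : ℝ) • shift c a + (2⁻¹ : ℝ) • shift c b := by
  simp only [shift]
  module

theorem shift_of_le {c d : ℝ} (hc : 0 < c) (hd : 0 < d) (a : A) :
    shift d a = (c / d) • shift c a + (1 - c / d) • shift c 0 := by
  simp only [shift]
  match_scalars
  · field_simp
    ring
  · field_simp

end Shift

section EffectAdditive

variable {A : Type*} [CStarAlgebra A] [PartialOrder A] [StarOrderedRing A]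

/-- A function on a C⋆-algebra that is nonnegative and additive on effects (the elements of
`[0, 1]`) and normalized. Its values outside `[0, 1]` are irrelevant. -/
structure IsEffectAdditive (v : A → ℝ) : Prop where
  nonneg : ∀ a, 0 ≤ a → a ≤ 1 → 0 ≤ v a
  one : v 1 = 1
  add : ∀ a b, 0 ≤ a → 0 ≤ b → a + b ≤ 1 → v (a + b) = v a + v b

namespace IsEffectAdditive

variable {v : A → ℝ}

theorem le_one (hv : IsEffectAdditive v) {a : A} (h0 : 0 ≤ a) (h1 : a ≤ 1) : v a ≤ 1 := by
  have h := hv.add a (1 - a) h0 (sub_nonneg.2 h1) (by simp)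
  have h2 := hv.nonneg (1 - a) (sub_nonneg.2 h1) (by simpa using h0)
  rw [add_sub_cancel, hv.one] at h
  linarith

theorem zero (hv : IsEffectAdditive v) : v 0 = 0 := by
  have h := hv.add 0 0 le_rfl le_rfl (by simp)
  rw [add_zero] at h
  linarith

/-- Effects are stable under scaling by `t ∈ [0, 1]`. -/
theorem smul_mem {a : A} (h0 : 0 ≤ a) (h1 : a ≤ 1) {t : ℝ} (ht0 : 0 ≤ t) (ht1 : t ≤ 1) :
    0 ≤ t • a ∧ t • a ≤ 1 :=
  ⟨smul_nonneg ht0 h0, (smul_le_of_le_one_left h0 ht1).trans h1⟩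

theorem add_smul (hv : IsEffectAdditive v) {a : A} (h0 : 0 ≤ a) (h1 : a ≤ 1) {s t : ℝ}
    (hs : 0 ≤ s) (ht : 0 ≤ t) (hst : s + t ≤ 1) : v ((s + t) • a) = v (s • a) + v (t • a) := by
  rw [_root_.add_smul]
  refine hv.add _ _ (smul_nonneg hs h0) (smul_nonneg ht h0) ?_
  rw [← _root_.add_smul]
  exact (smul_mem h0 h1 (add_nonneg hs ht) hst).2

theorem natCast_mul_smul (hv : IsEffectAdditive v) {a : A} (h0 : 0 ≤ a) (h1 : a ≤ 1) {s : ℝ}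
    (hs : 0 ≤ s) (k : ℕ) (hk : k * s ≤ 1) : v ((k * s) • a) = k * v (s • a) := by
  induction k with
  | zero => simp [hv.zero]
  | succ k ih =>
    push_cast at hk ⊢
    rw [add_mul, one_mul] at hk ⊢
    rw [hv.add_smul h0 h1 (by positivity) hs hk, ih (by linarith)]
    ring

/-- Homogeneity follows from additivity and positivity: `v (t • a)` and `t * v a` lie in a common
interval `[k / n * v a, (k + 1) / n * v a]`, for every `n`. -/
theorem smul (hv : IsEffectAdditive v) {a : A} (h0 : 0 ≤ a) (h1 : a ≤ 1) {t : ℝ}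
    (ht0 : 0 ≤ t) (ht1 : t ≤ 1) : v (t • a) = t * v a := by
  have key (n : ℕ) : |v (t • a) - t * v a| ≤ 1 / ((n : ℝ) + 1) := by
    have hn : (0 : ℝ) < (n : ℝ) + 1 := by positivity
    set s : ℝ := 1 / ((n : ℝ) + 1) with hs
    have hs0 : 0 ≤ s := by positivity
    have hs1 : ((n : ℝ) + 1) * s = 1 := by rw [hs]; field_simp
    set k := ⌊t * ((n : ℝ) + 1)⌋₊
    have hk1 : (k : ℝ) ≤ t * ((n : ℝ) + 1) := Nat.floor_le (by positivity)
    have hk2 : t * ((n : ℝ) + 1) < k + 1 := Nat.lt_floor_add_one _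
    have hks : k * s ≤ t := by
      calc k * s ≤ t * ((n : ℝ) + 1) * s := by gcongr
        _ = t := by rw [mul_assoc, hs1, mul_one]
    have hks' : t ≤ k * s + s := by
      calc t = t * ((n : ℝ) + 1) * s := by rw [mul_assoc, hs1, mul_one]
        _ ≤ (k + 1) * s := by gcongr
        _ = _ := by ring
    have e1 : v a = ((n : ℝ) + 1) * v (s • a) := by
      have := hv.natCast_mul_smul h0 h1 hs0 (n + 1) (by push_cast; exact hs1.le)
      push_cast at this
      rwa [hs1, one_smul] at this
    have e2 : v (t • a) = k * v (s • a) + v ((t - k * s) • a) := by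
      rw [← hv.natCast_mul_smul h0 h1 hs0 k (hks.trans ht1),
        ← hv.add_smul h0 h1 (by positivity) (by linarith) (by linarith)]
      congr 2
      ring
    have hr0 : 0 ≤ v ((t - k * s) • a) := by
      have := smul_mem h0 h1 (t := t - k * s) (by linarith) (by nlinarith)
      exact hv.nonneg _ this.1 this.2
    have hs1' : s ≤ 1 := by
      rw [hs, div_le_one hn]; linarith [(n : ℕ).cast_nonneg (α := ℝ)]
    have hr1 : v ((t - k * s) • a) ≤ v (s • a) := by
      have h := hv.add_smul h0 h1 (s := t - k * s) (t := s - (t - k * s)) (by linarith)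
        (by linarith) (by linarith)
      have := smul_mem h0 h1 (t := s - (t - k * s)) (by linarith) (by linarith)
      have := hv.nonneg _ this.1 this.2
      rw [add_sub_cancel] at h
      linarith
    have hva : v (s • a) ≤ s := by
      have := hv.le_one h0 h1
      nlinarith
    have hva0 : 0 ≤ v (s • a) := hr0.trans hr1
    have e3 : t * v a = (t * (n + 1)) * v (s • a) := by rw [e1]; ring
    rw [e2, e3, abs_le]
    constructor <;> nlinarith
  exact sub_eq_zero.1 (abs_nonpos_iff.1
    (ge_of_tendsto' tendsto_one_div_add_atTop_nhds_zero_nat key))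

theorem shift_mem {c : ℝ} (hc : 0 < c) {a : A} (ha : IsSelfAdjoint a) (hac : ‖a‖ ≤ c) :
    0 ≤ shift c a ∧ shift c a ≤ 1 := by
  have hsa : IsSelfAdjoint (c⁻¹ • a) := (IsSelfAdjoint.all c⁻¹).smul ha
  have hn : ‖c⁻¹ • a‖ ≤ 1 := by
    rw [norm_smul, Real.norm_of_nonneg (by positivity)]
    exact inv_mul_le_one_of_le₀ hac hc.le
  have h1 : c⁻¹ • a ≤ 1 := by
    refine hsa.le_algebraMap_norm_self.trans ?_
    simpa using algebraMap_mono A hn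
  have h2 : -1 ≤ c⁻¹ • a := by
    refine le_trans ?_ hsa.neg_algebraMap_norm_le_self
    simpa using algebraMap_mono A hn
  refine ⟨smul_nonneg (by norm_num) (by simpa [add_comm] using neg_le_iff_add_nonneg.1 h2), ?_⟩
  calc shift c a ≤ (2⁻¹ : ℝ) • (1 + 1) := by unfold shift; gcongr
    _ = 1 := by rw [← two_smul ℝ (1 : A), smul_smul]; norm_num

variable (v) in
/-- The extension of `v` to self-adjoint elements: `c * (2 * v ((1 + a / c) / 2) - 1)` for the
scale `c = ‖a‖ + 1`, which is positive also for `a = 0`. See `extend_eq` for the independence of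
the scale. -/
def extend (a : A) : ℝ := (‖a‖ + 1) * (2 * v (shift (‖a‖ + 1) a) - 1)

theorem apply_shift_zero (hv : IsEffectAdditive v) (c : ℝ) : v (shift c 0) = 2⁻¹ := by
  rw [shift, smul_zero, add_zero, hv.smul zero_le_one le_rfl (by norm_num) (by norm_num), hv.one,
    mul_one]

theorem scale_eq (hv : IsEffectAdditive v) {a : A} (ha : IsSelfAdjoint a) {c d : ℝ}
    (hc : 0 < c) (hac : ‖a‖ ≤ c) (hcd : c ≤ d) :
    d * (2 * v (shift d a) - 1) = c * (2 * v (shift c a) - 1) := by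
  have hd : 0 < d := hc.trans_le hcd
  have ha' := shift_mem hc ha hac
  have h0 := shift_mem hc (.zero A) (by simpa using hc.le)
  have h1 : c / d ≤ 1 := (div_le_one hd).2 hcd
  have h2 : 0 ≤ c / d := by positivity
  have h3 := shift_mem hd ha (hac.trans hcd)
  rw [shift_of_le hc hd] at h3
  rw [shift_of_le hc hd, hv.add _ _ (smul_nonneg h2 ha'.1) (smul_nonneg (by linarith) h0.1) h3.2,
    hv.smul ha'.1 ha'.2 h2 h1, hv.smul h0.1 h0.2 (by linarith) (by linarith), hv.apply_shift_zero]
  field_simp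
  ring

/-- The extension can be computed with any scale `c ≥ ‖a‖`, so two elements can share a scale. -/
theorem extend_eq (hv : IsEffectAdditive v) {a : A} (ha : IsSelfAdjoint a) {c : ℝ}
    (hc : 0 < c) (hac : ‖a‖ ≤ c) : extend v a = c * (2 * v (shift c a) - 1) := by
  rcases le_total c (‖a‖ + 1) with h | h
  · exact hv.scale_eq ha hc hac h
  · exact (hv.scale_eq ha (by positivity) (by linarith) h).symm

theorem extend_add (hv : IsEffectAdditive v) {a b : A} (ha : IsSelfAdjoint a)
    (hb : IsSelfAdjoint b) : extend v (a + b) = extend v a + extend v b := by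
  set c : ℝ := ‖a‖ + ‖b‖ + 1
  have hc : 0 < c := by positivity
  have hac : ‖a‖ ≤ c := by linarith [norm_nonneg b]
  have hbc : ‖b‖ ≤ c := by linarith [norm_nonneg a]
  have ha' := shift_mem hc ha hac
  have hb' := shift_mem hc hb hbc
  have hab : ‖a + b‖ ≤ 2 * c := by linarith [norm_add_le a b]
  have hab' := shift_mem (by positivity) (ha.add hb) hab
  rw [shift_add] at hab'
  rw [hv.extend_eq ha hc hac, hv.extend_eq hb hc hbc, hv.extend_eq (ha.add hb) (by positivity) hab,
    shift_add, hv.add _ _ (smul_nonneg (by norm_num) ha'.1) (smul_nonneg (by norm_num) hb'.1)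
      hab'.2,
    hv.smul ha'.1 ha'.2 (by norm_num) (by norm_num),
    hv.smul hb'.1 hb'.2 (by norm_num) (by norm_num)]
  ring

theorem abs_extend_le (hv : IsEffectAdditive v) {a : A} (ha : IsSelfAdjoint a) :
    |extend v a| ≤ ‖a‖ := by
  refine le_of_forall_gt_imp_ge_of_dense fun c hc => ?_
  have hc0 : 0 < c := (norm_nonneg a).trans_lt hc
  have h := shift_mem hc0 ha hc.le
  have h0 := hv.nonneg _ h.1 h.2
  have h1 := hv.le_one h.1 h.2
  rw [hv.extend_eq ha hc0 hc.le, abs_le]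
  constructor <;> nlinarith

theorem extend_eq_self (hv : IsEffectAdditive v) {a : A} (h0 : 0 ≤ a) (h1 : a ≤ 1) :
    extend v a = v a := by
  have ha : IsSelfAdjoint a := .of_nonneg h0
  have hn : ‖a‖ ≤ 1 := (CStarAlgebra.norm_le_one_iff_of_nonneg a h0).2 h1
  have h2 := shift_mem one_pos ha hn
  have e : shift 1 a = (2⁻¹ : ℝ) • 1 + (2⁻¹ : ℝ) • a := by simp [shift]
  rw [e] at h2
  have h3 : (0 : ℝ) ≤ 2⁻¹ := by norm_num
  rw [hv.extend_eq ha one_pos hn, e,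
    hv.add _ _ (smul_nonneg h3 zero_le_one) (smul_nonneg h3 h0) h2.2,
    hv.smul zero_le_one le_rfl h3 (by norm_num), hv.smul h0 h1 h3 (by norm_num), hv.one]
  ring

/-- An additive function on effects extends to a bounded complex linear functional. -/
theorem exists_strongDual (hv : IsEffectAdditive v) :
    ∃ L : StrongDual ℂ A, ∀ a, 0 ≤ a → a ≤ 1 → L a = v a := by
  let V : A →+ ℝ :=
    { toFun := fun a => extend v (realPart a : A)
      map_zero' := by
        have := hv.abs_extend_le (a := (0 : A)) (.zero A)
        simpa using this
      map_add' := fun a b => by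
        simp only [map_add, AddSubgroup.coe_add]
        exact hv.extend_add (realPart a).2 (realPart b).2 }
  -- An additive map that is bounded is continuous, hence real-linear.
  have hV : Continuous V := AddMonoidHomClass.continuous_of_bound V 1 fun a => by
    rw [one_mul]
    exact (hv.abs_extend_le (realPart a).2).trans (realPart.norm_le a)
  let f : StrongDual ℝ A := V.toRealLinearMap hV
  refine ⟨f.extendRCLike, fun a h0 h1 => ?_⟩
  have ha : IsSelfAdjoint a := .of_nonneg h0
  have e1 : f a = v a := by
    have : f a = extend v (realPart a : A) := rfl
    rw [this, ha.coe_realPart, hv.extend_eq_self h0 h1]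
  have e2 : f (Complex.I • a) = 0 := by
    have : f (Complex.I • a) = extend v (realPart (Complex.I • a) : A) := rfl
    rw [this, realPart_I_smul, ha.imaginaryPart]
    simpa using hv.abs_extend_le (a := (0 : A)) (.zero A)
  rw [StrongDual.extendRCLike_apply]
  simp [e1, e2]

end IsEffectAdditive

end EffectAdditive

/-! ### Construction of POVMs -/

section Construction

open InnerProductSpace

variable {H : Type v} [NormedAddCommGroup H] [InnerProductSpace ℂ H] [CompleteSpace H]

/-- Disjoint additivity of unconditional sums over subsets of an index set. -/
theorem hasSum_of_hasSum_indicator {X : Type*} {f : X → ℂ} {E : ℕ → Set X}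
    (hE : Pairwise fun m n => Disjoint (E m) (E n)) {a : ℕ → ℂ} {s : ℂ}
    (ha : ∀ n, HasSum ((E n).indicator f) (a n)) (hs : HasSum ((⋃ n, E n).indicator f) s) :
    HasSum a s := by
  rw [← hasSum_subtype_iff_indicator] at hs
  rw [← (Set.unionEqSigmaOfDisjoint hE).symm.hasSum_iff] at hs
  exact hs.sigma fun n => hasSum_subtype_iff_indicator.2 (ha n)

/-- The POVM whose value on an event `S` is the operator `T S`, the weak sum of the operators
`e i` over the outcomes `i ∈ S`. -/
def POVM.ofWeakSum {X : Type u} [MeasurableSpace X] (e : X → H →L[ℂ] H) (T : Set X → H →L[ℂ] H)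
    (hT : ∀ S x y, HasSum (S.indicator fun i => inner ℂ x (e i y)) (inner ℂ x (T S y)))
    (hT0 : ∀ S, 0 ≤ T S) (hT1 : T Set.univ = 1) : POVM H X where
  toFun S := ⟨T S, IsSelfAdjoint.of_nonneg (hT0 S)⟩
  nonneg S := hT0 S
  univ := hT1
  hasSum_iUnion E hE x y :=
    hasSum_of_hasSum_indicator hE (fun n => hT (E n) x y) (hT (⋃ n, E n) x y)

open Classical in
/-- The POVM with finitely many outcomes given by positive operators with sum `1`. -/
def POVM.ofFintype {X : Type u} [MeasurableSpace X] [Fintype X] (e : X → H →L[ℂ] H)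
    (he : ∀ i, 0 ≤ e i) (h1 : ∑ i, e i = 1) : POVM H X :=
  POVM.ofWeakSum e (fun S => ∑ i, if i ∈ S then e i else 0)
    (fun S x y => by
      have : inner ℂ x ((∑ i, if i ∈ S then e i else 0) y) =
          ∑ i, S.indicator (fun i => inner ℂ x (e i y)) i := by
        rw [_root_.sum_apply, inner_sum]
        refine Finset.sum_congr rfl fun i _ => ?_
        by_cases h : i ∈ S <;> simp [h]
      rw [this]
      exact hasSum_fintype _)
    (fun S => Finset.sum_nonneg fun i _ => by split_ifs <;> simp [he i])
    (by simpa using h1)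

/-- The spectral projections of an orthonormal basis: for a set `S` of indices, the projection
onto the closed span of the basis vectors indexed by `S`. -/
theorem exists_projection {ι : Type*} (b : HilbertBasis ι ℂ H) :
    ∃ P : Set ι → H →L[ℂ] H, (∀ S, 0 ≤ P S) ∧ P Set.univ = 1 ∧
      ∀ S x y, HasSum (S.indicator fun i => inner ℂ x (b i) * inner ℂ (b i) y)
        (inner ℂ x (P S y)) := by
  let K (S : Set ι) : Submodule ℂ H := (Submodule.span ℂ (b '' S)).topologicalClosure
  have hP (S : Set ι) (x y : H) :
      HasSum (S.indicator fun i => inner ℂ x (b i) * inner ℂ (b i) y)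
        (inner ℂ x ((K S).starProjection y)) := by
    refine (b.hasSum_inner_mul_inner x ((K S).starProjection y)).congr_fun fun i => ?_
    rw [← Submodule.inner_starProjection_left_eq_right]
    by_cases hi : i ∈ S
    · have : b i ∈ K S := Submodule.le_topologicalClosure _
        (Submodule.subset_span (Set.mem_image_of_mem b hi))
      rw [Submodule.starProjection_eq_self_iff.2 this, Set.indicator_of_mem hi]
    · have : b i ∈ (K S)ᗮ := by
        rw [Submodule.orthogonal_closure, Submodule.mem_orthogonal]
        intro u hu
        induction hu using Submodule.span_induction with
        | mem u hu =>
          obtain ⟨j, hj, rfl⟩ := hu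
          exact b.orthonormal.2 fun h => hi (h ▸ hj)
        | zero => simp
        | add u w _ _ h1 h2 => rw [inner_add_left, h1, h2, add_zero]
        | smul c u _ h => rw [inner_smul_left, h, mul_zero]
      rw [(Submodule.starProjection_apply_eq_zero_iff _).2 this, Set.indicator_of_notMem hi]
      simp
  refine ⟨fun S => (K S).starProjection, fun S => ?_, ?_, hP⟩
  · exact (isStarProjection_starProjection).nonneg
  · refine ContinuousLinearMap.ext fun y => ext_inner_left ℂ fun x => ?_
    have h := hP Set.univ x y
    rw [Set.indicator_univ] at h
    exact h.unique (b.hasSum_inner_mul_inner x y)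

/-- For an effect `M` and an orthonormal basis `b`, the POVM with outcome operators
`√M |bᵢ⟩⟨bᵢ| √M` and the complement `1 - M` of their weak sum `M`. -/
theorem exists_povm_sqrt {ι : Type u} [MeasurableSpace (Option ι)] (b : HilbertBasis ι ℂ H)
    {M : H →L[ℂ] H} (h0 : 0 ≤ M) (h1 : M ≤ 1) :
    ∃ μ : POVM H (Option ι), (∀ S, none ∉ S.1 → Set.range some ⊆ S.1 →
        (μ.toFun S : H →L[ℂ] H) = M) ∧
      ∀ S i, S.1 = {some i} →
        (μ.toFun S : H →L[ℂ] H) = rankOne ℂ (CFC.sqrt M (b i)) (CFC.sqrt M (b i)) := by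
  classical
  obtain ⟨P, hP0, hP1, hP⟩ := exists_projection b
  set A := CFC.sqrt M with hA
  have hA0 : 0 ≤ A := CFC.sqrt_nonneg _
  have hAA : A * A = M := CFC.sqrt_mul_sqrt_self M h0
  have hAi (x y : H) : inner ℂ (A x) y = inner ℂ x (A y) :=
    ((ContinuousLinearMap.nonneg_iff_isPositive _).1 hA0).inner_left_eq_inner_right x y
  let e : Option ι → H →L[ℂ] H := fun o => o.elim (1 - M) fun i => rankOne ℂ (A (b i)) (A (b i))
  -- The outcome `none` carries the complement `1 - M`.
  let T : Set (Option ι) → H →L[ℂ] H := fun S =>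
    A * P (some ⁻¹' S) * A + if none ∈ S then 1 - M else 0
  have hT (S : Set (Option ι)) (x y : H) :
      HasSum (S.indicator fun i => inner ℂ x (e i y)) (inner ℂ x (T S y)) := by
    have h2 := hP (some ⁻¹' S) (A x) (A y)
    let g : Option ι → ℂ := fun o => o.elim 0 fun i =>
      (some ⁻¹' S).indicator (fun i => inner ℂ (A x) (b i) * inner ℂ (b i) (A y)) i
    have hg : HasSum g (inner ℂ (A x) (P (some ⁻¹' S) (A y))) := by
      refine ((Option.some_injective ι).hasSum_iff fun o ho => ?_).1 h2
      cases o with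
      | none => rfl
      | some i => exact absurd ⟨i, rfl⟩ ho
    have h3 := hg.add (hasSum_ite_eq (none : Option ι)
      (if none ∈ S then inner ℂ x ((1 - M) y) else 0))
    have h4 : inner ℂ x (T S y) = inner ℂ (A x) (P (some ⁻¹' S) (A y)) +
        if none ∈ S then inner ℂ x ((1 - M) y) else 0 := by
      rw [hAi]
      by_cases h : none ∈ S <;> simp [T, h]
    rw [h4]
    refine h3.congr_fun fun o => ?_
    cases o with
    | none => by_cases h : none ∈ S <;> simp [g, e, h]
    | some i =>
      by_cases h : some i ∈ S
      · simp [g, e, h, hAi, mul_comm]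
      · simp [g, h]
  have hT0 (S : Set (Option ι)) : 0 ≤ T S := by
    refine add_nonneg (conjugate_nonneg_of_nonneg (hP0 _) hA0) ?_
    split_ifs
    exacts [sub_nonneg.2 h1, le_rfl]
  have hT1 : T Set.univ = 1 := by simp [T, hP1, hAA]
  refine ⟨POVM.ofWeakSum e T hT hT0 hT1, fun S hS hS' => ?_, fun S i hS => ?_⟩
  · change T S.1 = M
    have : some ⁻¹' S.1 = (Set.univ : Set ι) :=
      Set.eq_univ_of_forall fun i => hS' ⟨i, rfl⟩
    simp [T, hS, this, hP1, hAA]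
  · change T S.1 = _
    refine ContinuousLinearMap.ext fun y => ext_inner_left ℂ fun x => ?_
    refine (hT S.1 x y).unique ?_
    rw [hS]
    have h := hasSum_ite_eq (some i : Option ι) (inner ℂ x (e (some i) y))
    refine h.congr_fun fun o => ?_
    by_cases ho : o = some i
    · subst ho; simp
    · simp [ho]

/-- Finite additivity, from σ-additivity on `E, Eᶜ, ∅, ∅, …`. -/
theorem POVM.add_compl {X : Type u} [MeasurableSpace X] (μ : POVM H X)
    (E : {E : Set X // MeasurableSet E}) :
    (μ.toFun E : H →L[ℂ] H) + (μ.toFun ⟨(E : Set X)ᶜ, E.2.compl⟩ : H →L[ℂ] H) = 1 := by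
  let F : ℕ → {E : Set X // MeasurableSet E} := fun n =>
    if n = 0 then E else if n = 1 then ⟨(E : Set X)ᶜ, E.2.compl⟩ else ⟨∅, MeasurableSet.empty⟩
  have hF : Pairwise fun m n => Disjoint (F m : Set X) (F n : Set X) := by
    intro m n hmn
    rcases m with _ | _ | m <;> rcases n with _ | _ | n <;>
      simp [F, disjoint_compl_right, disjoint_compl_left] at hmn ⊢
  have hU : (⋃ n, (F n : Set X)) = Set.univ := by
    refine Set.eq_univ_of_forall fun x => Set.mem_iUnion.2 ?_
    by_cases hx : x ∈ (E : Set X)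
    · exact ⟨0, by simpa [F] using hx⟩
    · exact ⟨1, by simpa [F] using hx⟩
  refine ContinuousLinearMap.ext fun y => ext_inner_left ℂ fun x => ?_
  have h := μ.hasSum_iUnion F hF x y
  have h2 : (⟨⋃ n, (F n : Set X), MeasurableSet.iUnion fun n => (F n).2⟩ :
      {E : Set X // MeasurableSet E}) = ⟨Set.univ, MeasurableSet.univ⟩ := Subtype.ext hU
  rw [h2, μ.univ] at h
  have h3 := hasSum_sum_of_ne_finset_zero (L := .unconditional ℕ) (s := Finset.range 2)
    (f := fun n => inner ℂ x ((μ.toFun (F n) : H →L[ℂ] H) y)) fun n hn => by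
      have hn2 : ¬ n < 2 := Finset.mem_range.not.1 hn
      have : F n = ⟨∅, MeasurableSet.empty⟩ := by
        simp only [F]
        rw [if_neg (by omega), if_neg (by omega)]
      rw [this, μ.empty]
      simp
  rw [← h3.unique h]
  simp [Finset.sum_range_succ, F, inner_add_right]

theorem POVM.le_one {X : Type u} [MeasurableSpace X] (μ : POVM H X)
    (E : {E : Set X // MeasurableSet E}) : (μ.toFun E : H →L[ℂ] H) ≤ 1 := by
  rw [← μ.add_compl E]
  exact le_add_of_nonneg_right (μ.nonneg _)

/-- The two-outcome POVM of an effect `M`. -/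
def POVM.binary (M : H →L[ℂ] H) (h0 : 0 ≤ M) (h1 : M ≤ 1) : POVM H (ULift.{u} Bool) :=
  POVM.ofFintype (fun i => if i.down then M else 1 - M)
    (fun i => by split_ifs; exacts [h0, sub_nonneg.2 h1])
    (by
      rw [← Equiv.ulift.symm.sum_comp]
      simp)

theorem POVM.binary_apply (M : H →L[ℂ] H) (h0 : 0 ≤ M) (h1 : M ≤ 1)
    (S : {E : Set (ULift.{u} Bool) // MeasurableSet E}) [Decidable (⟨true⟩ ∈ S.1)]
    [Decidable (⟨false⟩ ∈ S.1)] :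
    ((POVM.binary M h0 h1).toFun S : H →L[ℂ] H) =
      (if ⟨true⟩ ∈ S.1 then M else 0) + if ⟨false⟩ ∈ S.1 then 1 - M else 0 := by
  classical
  have : ((POVM.binary M h0 h1).toFun S : H →L[ℂ] H) =
    ∑ i : ULift.{u} Bool, if i ∈ S.1 then (if i.down then M else 1 - M) else 0 := by
      simp only [binary, ofFintype, ofWeakSum]
  rw [this, ← Equiv.ulift.symm.sum_comp]
  simp

/-- Every event of a POVM is the pullback of the first outcome of a binary POVM. -/
theorem POVM.map_eq_binary {X : Type u} [MeasurableSpace X] (μ : POVM H X)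
    (E : {E : Set X // MeasurableSet E}) (f : X → ULift.{u} Bool) (hf : Measurable f)
    (hE : ∀ x, f x = ⟨true⟩ ↔ x ∈ (E : Set X)) :
    POVM.map f hf μ = POVM.binary (μ.toFun E) (μ.nonneg E) (μ.le_one E) := by
  classical
  refine POVM.ext (funext fun S => Subtype.ext ?_)
  rw [POVM.binary_apply]
  have hE' (x) : f x = ⟨false⟩ ↔ x ∉ (E : Set X) := by
    rw [← hE, ULift.ext_iff, ULift.ext_iff]
    simp
  have key (F : Set X) (hF : MeasurableSet F) (h : ∀ x, f x ∈ S.1 ↔ x ∈ F) :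
      ((POVM.map f hf μ).toFun S : H →L[ℂ] H) = μ.toFun ⟨F, hF⟩ := by
    have : (⟨f ⁻¹' S.1, hf S.2⟩ : {E : Set X // MeasurableSet E}) = ⟨F, hF⟩ :=
      Subtype.ext (Set.ext h)
    rw [← this]
    rfl
  have hcases (x) : (x ∈ (E : Set X) ∧ f x = ⟨true⟩) ∨ (x ∉ (E : Set X) ∧ f x = ⟨false⟩) := by
    by_cases hx : x ∈ (E : Set X)
    · exact .inl ⟨hx, (hE x).2 hx⟩
    · exact .inr ⟨hx, (hE' x).2 hx⟩
  have hc := eq_sub_of_add_eq' (μ.add_compl E)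
  by_cases ht : (⟨true⟩ : ULift Bool) ∈ S.1 <;> by_cases hb : (⟨false⟩ : ULift Bool) ∈ S.1
  · rw [key Set.univ MeasurableSet.univ fun x => by
      rcases hcases x with h | h <;> simp [h, ht, hb], μ.univ]
    simp [ht, hb]
  · rw [key E E.2 fun x => by rcases hcases x with h | h <;> simp [h, ht, hb]]
    simp [ht, hb]
  · rw [key _ E.2.compl fun x => by rcases hcases x with h | h <;> simp [h, ht, hb], hc]
    simp [ht, hb]
  · rw [key ∅ MeasurableSet.empty fun x => by
      rcases hcases x with h | h <;> simp [h, ht, hb], μ.empty]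
    simp [ht, hb]

end Construction

/-! ### Natural transformations as functions on effects -/

section Naturality

open InnerProductSpace

variable {H : Type u} [NormedAddCommGroup H] [InnerProductSpace ℂ H] [CompleteSpace H]

/-- The component of a natural transformation, as a function from POVMs to probability measures. -/
def component (η : measurementFunctor H ⟶ probabilityFunctor.{u}) {X : Type u}
    [MeasurableSpace X] (μ : POVM H X) : ProbabilityMeasure X :=
  η.app (MeasCat.of X) μ

theorem component_map (η : measurementFunctor H ⟶ probabilityFunctor.{u}) {X Y : Type u}
    [MeasurableSpace X] [MeasurableSpace Y] (μ : POVM H X) (f : X → Y) (hf : Measurable f) :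
    component η (POVM.map f hf μ) = (component η μ).map hf.aemeasurable :=
  ConcreteCategory.congr_hom
    (η.naturality (X := MeasCat.of X) (Y := MeasCat.of Y) ⟨f, hf⟩) μ

open Classical in
/-- The probability that a natural transformation assigns to an effect `M`: that of the first
outcome of the binary POVM of `M`. It is `0` if `M` is not an effect. -/
def effectProb (η : measurementFunctor H ⟶ probabilityFunctor.{u}) (M : H →L[ℂ] H) : ℝ :=
  if h : 0 ≤ M ∧ M ≤ 1 then
    (component η (POVM.binary M h.1 h.2) : Measure (ULift.{u} Bool)).real {⟨true⟩}
  else 0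

/-- By naturality, the probability of an event depends only on its effect. -/
theorem component_apply (η : measurementFunctor H ⟶ probabilityFunctor.{u}) {X : Type u}
    [MeasurableSpace X] (μ : POVM H X) (E : {E : Set X // MeasurableSet E}) :
    (component η μ : Measure X).real E = effectProb η (μ.toFun E) := by
  classical
  let f : X → ULift.{u} Bool := fun x => ⟨decide (x ∈ (E : Set X))⟩
  have hE (x) : f x = ⟨true⟩ ↔ x ∈ (E : Set X) := by simp [f]
  have hf : Measurable f := by
    refine measurable_up.comp (measurable_to_bool ?_)
    convert E.2 using 1
    ext x
    simp
  rw [effectProb, dif_pos ⟨μ.nonneg E, μ.le_one E⟩, ← μ.map_eq_binary E f hf hE, component_map]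
  have h : f ⁻¹' {⟨true⟩} = (E : Set X) := Set.ext hE
  rw [ProbabilityMeasure.toMeasure_map, map_measureReal_apply hf (measurableSet_singleton _), h]

theorem isEffectAdditive_effectProb (η : measurementFunctor H ⟶ probabilityFunctor.{u}) :
    IsEffectAdditive (effectProb η) where
  nonneg a h0 h1 := by
    rw [effectProb, dif_pos ⟨h0, h1⟩]
    exact measureReal_nonneg
  one := by
    have h := component_apply η (POVM.binary (1 : H →L[ℂ] H) zero_le_one le_rfl)
      ⟨Set.univ, MeasurableSet.univ⟩
    rw [POVM.univ] at h
    simpa using h.symm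
  add a b ha hb hab := by
    classical
    let e : ULift.{u} (Fin 3) → H →L[ℂ] H := fun i => ![a, b, 1 - (a + b)] i.down
    have he (i) : 0 ≤ e i := by
      obtain ⟨i⟩ := i
      fin_cases i
      exacts [ha, hb, sub_nonneg.2 hab]
    have he1 : ∑ i, e i = 1 := by
      rw [← Equiv.ulift.symm.sum_comp]
      simp [e, Fin.sum_univ_three]
    let μ : POVM H (ULift.{u} (Fin 3)) := POVM.ofFintype e he he1
    have hμ (S : {E : Set (ULift.{u} (Fin 3)) // MeasurableSet E}) :
        (μ.toFun S : H →L[ℂ] H) = ∑ i, if i ∈ S.1 then e i else 0 := by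
      simp only [μ, POVM.ofFintype, POVM.ofWeakSum]
    have h0 := component_apply η μ ⟨{⟨0⟩}, measurableSet_singleton _⟩
    have h1 := component_apply η μ ⟨{⟨1⟩}, measurableSet_singleton _⟩
    have h2 := component_apply η μ ⟨{⟨0⟩} ∪ {⟨1⟩},
      (measurableSet_singleton _).union (measurableSet_singleton _)⟩
    have hd : Disjoint ({⟨0⟩} : Set (ULift.{u} (Fin 3))) {⟨1⟩} := by simp [ULift.ext_iff]
    rw [hμ, ← Equiv.ulift.symm.sum_comp] at h0 h1 h2
    have h3 := measureReal_union (μ := (component η μ : Measure (ULift.{u} (Fin 3)))) hd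
      (measurableSet_singleton _)
    rw [h0, h1, h2] at h3
    simpa [Fin.sum_univ_three, e, ULift.ext_iff] using h3

/-- Two natural transformations with the same probabilities on effects are equal. -/
theorem natTrans_ext {η θ : measurementFunctor H ⟶ probabilityFunctor.{u}}
    (h : ∀ M, 0 ≤ M → M ≤ 1 → effectProb η M = effectProb θ M) : η = θ := by
  have key {X : Type u} [MeasurableSpace X] (μ : POVM H X) : component η μ = component θ μ := by
    refine Subtype.ext (Measure.ext fun E hE => ?_)
    have h2 := component_apply η μ ⟨E, hE⟩
    rw [h _ (μ.nonneg _) (μ.le_one _), ← component_apply] at h2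
    have h3 : (component η μ : Measure X) E = (component θ μ : Measure X) E :=
      (measureReal_eq_measureReal_iff (measure_ne_top _ _) (measure_ne_top _ _)).1 h2
    exact h3
  exact NatTrans.ext (funext fun X => ConcreteCategory.hom_ext _ _ fun (μ : POVM H X) => key μ)

theorem countable_of_hilbertBasis {H : Type*} [NormedAddCommGroup H] [InnerProductSpace ℂ H]
    [TopologicalSpace.SeparableSpace H] {ι : Type*} (b : HilbertBasis ι ℂ H) : Countable ι := by
  have hd : Pairwise (Function.onFun Disjoint fun i => Metric.ball (b i) (1 / 2)) := by
    intro i j hij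
    refine Metric.ball_disjoint_ball ?_
    have h : ‖b i - b j‖ ^ 2 = 2 := by
      rw [@norm_sub_sq ℂ, b.orthonormal.1, b.orthonormal.1, b.orthonormal.2 hij]
      norm_num
    rw [dist_eq_norm]
    nlinarith [norm_nonneg (b i - b j)]
  exact Pairwise.countable_of_isOpen_disjoint hd (fun _ => Metric.isOpen_ball)
    fun _ => Metric.nonempty_ball.2 (by norm_num)

/-- Normality: an effect `M` is the weak sum of the rank-one effects `√M |bᵢ⟩⟨bᵢ| √M`, which are
outcomes of a single POVM, so σ-additivity of the associated probability measure applies. -/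
theorem hasSum_effectProb [TopologicalSpace.SeparableSpace H]
    (η : measurementFunctor H ⟶ probabilityFunctor.{u}) {ι : Type u} (b : HilbertBasis ι ℂ H)
    {M : H →L[ℂ] H} (h0 : 0 ≤ M) (h1 : M ≤ 1) :
    HasSum (fun i => effectProb η (rankOne ℂ (CFC.sqrt M (b i)) (CFC.sqrt M (b i))))
      (effectProb η M) := by
  have := countable_of_hilbertBasis b
  let _ : MeasurableSpace (Option ι) := ⊤
  obtain ⟨μ, hμ, hμ'⟩ := exists_povm_sqrt b h0 h1
  have e1 (i : ι) : effectProb η (rankOne ℂ (CFC.sqrt M (b i)) (CFC.sqrt M (b i))) =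
      (component η μ : Measure (Option ι)).real {some i} := by
    rw [component_apply η μ ⟨{some i}, trivial⟩, hμ' _ i rfl]
  have e2 : effectProb η M =
      (component η μ : Measure (Option ι)).real (⋃ i : ι, {some i}) := by
    rw [component_apply η μ ⟨⋃ i : ι, {some i}, trivial⟩, hμ _ (by simp) ?_]
    rintro _ ⟨i, rfl⟩
    exact Set.mem_iUnion.2 ⟨i, rfl⟩
  simp only [e1, e2]
  have hd : Pairwise (Function.onFun Disjoint fun i : ι => ({some i} : Set (Option ι))) := by
    intro i j hij
    simpa [Function.onFun] using hij
  have h := measure_iUnion (μ := (component η μ : Measure (Option ι))) hd fun i => trivial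
  have hfin := measure_ne_top (component η μ : Measure (Option ι)) (⋃ i : ι, {some i})
  simp only [Measure.real]
  rw [h] at hfin ⊢
  rw [ENNReal.tsum_toReal_eq fun i => measure_ne_top _ _]
  exact ENNReal.hasSum_toReal hfin

/-- `|x⟩⟨x|` is an effect when `‖x‖ ≤ 1`. -/
theorem rankOne_self_mem {x : H} (hx : ‖x‖ ≤ 1) :
    0 ≤ rankOne ℂ x x ∧ rankOne ℂ x x ≤ 1 := by
  have h : 0 ≤ rankOne ℂ x x :=
    (ContinuousLinearMap.nonneg_iff_isPositive _).2 (isPositive_rankOne_self x)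
  refine ⟨h, (CStarAlgebra.norm_le_one_iff_of_nonneg _ h).1 ?_⟩
  rw [norm_rankOne]
  exact mul_le_one₀ hx (norm_nonneg _) hx

theorem norm_sqrt_basis_le {ι : Type*} (b : HilbertBasis ι ℂ H) {M : H →L[ℂ] H} (h1 : M ≤ 1)
    (i : ι) : ‖CFC.sqrt M (b i)‖ ≤ 1 := by
  refine (ContinuousLinearMap.le_opNorm _ _).trans ?_
  rw [b.orthonormal.1, mul_one, CStarAlgebra.norm_le_one_iff_of_nonneg _ (CFC.sqrt_nonneg _)]
  simpa using CFC.sqrt_le_sqrt M 1 h1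

/-- A natural transformation is determined by its probabilities on rank-one effects. -/
theorem natTrans_ext_rankOne [TopologicalSpace.SeparableSpace H]
    {η θ : measurementFunctor H ⟶ probabilityFunctor.{u}}
    (h : ∀ x : H, ‖x‖ ≤ 1 → effectProb η (rankOne ℂ x x) = effectProb θ (rankOne ℂ x x)) :
    η = θ := by
  refine natTrans_ext fun M h0 h1 => ?_
  have h2 := hasSum_effectProb η (stdBasis H) h0 h1
  simp only [fun i => h _ (norm_sqrt_basis_le (stdBasis H) h1 i)] at h2
  exact h2.unique (hasSum_effectProb θ (stdBasis H) h0 h1)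

end Naturality

/-! ### Density operators and the Born rule -/

section Density

open InnerProductSpace

variable {H : Type u} [NormedAddCommGroup H] [InnerProductSpace ℂ H] [CompleteSpace H]

theorem component_bornNatTrans (ρ : DensityOperator H) {X : Type u} [MeasurableSpace X]
    (μ : POVM H X) : component (bornNatTrans ρ) μ = born ρ μ :=
  rfl

/-- The Born rule gives `Tr[|x⟩⟨x| ρ] = ⟨ρ x, x⟩`, by Parseval's identity. -/
theorem effectProb_bornNatTrans (ρ : DensityOperator H) {x : H} (hx : ‖x‖ ≤ 1) :
    (effectProb (bornNatTrans ρ) (rankOne ℂ x x) : ℂ) = inner ℂ (ρ.op x) x := by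
  classical
  obtain ⟨h0, h1⟩ := rankOne_self_mem hx
  have h2 := born_apply ρ (POVM.binary.{u} _ h0 h1) ⟨{⟨true⟩}, measurableSet_singleton _⟩
  have h3 : ((POVM.binary.{u} _ h0 h1).toFun ⟨{⟨true⟩}, measurableSet_singleton _⟩ : H →L[ℂ] H) =
      rankOne ℂ x x := by
    rw [POVM.binary_apply]
    simp
  rw [h3] at h2
  rw [effectProb, dif_pos ⟨h0, h1⟩, component_bornNatTrans, h2]
  refine (ρ.hasSum_trace_mul (stdBasis H) _).unique ?_
  refine ((stdBasis H).hasSum_inner_mul_inner (ρ.op x) x).congr_fun fun i => ?_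
  have h4 := ((ContinuousLinearMap.nonneg_iff_isPositive _).1
    ρ.nonneg).inner_left_eq_inner_right x (stdBasis H i)
  simp [h4]

/-- A bounded functional on operators that is nonnegative on effects is represented on rank-one
operators by a positive operator. -/
theorem exists_operator (L : StrongDual ℂ (H →L[ℂ] H))
    (hL : ∀ M, 0 ≤ M → M ≤ 1 → ∃ r : ℝ, 0 ≤ r ∧ L M = r) :
    ∃ R : H →L[ℂ] H, 0 ≤ R ∧ ∀ x, inner ℂ (R x) x = L (rankOne ℂ x x) := by
  let B : H →L⋆[ℂ] H →L[ℂ] ℂ :=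
    (ContinuousLinearMap.compL ℂ H (H →L[ℂ] H) ℂ L).comp (rankOne ℂ (E := H) (F := H)).flip
  have hB (x : H) : inner ℂ (continuousLinearMapOfBilin B x) x = L (rankOne ℂ x x) :=
    continuousLinearMapOfBilin_apply B x x
  refine ⟨continuousLinearMapOfBilin B, ?_, hB⟩
  rw [ContinuousLinearMap.nonneg_iff_isPositive, ContinuousLinearMap.isPositive_iff_complex]
  intro x
  rw [hB]
  obtain ⟨r, hr, h⟩ : ∃ r : ℝ, 0 ≤ r ∧ L (rankOne ℂ x x) = r := by
    -- Only effects are covered by `hL`, so `x` is scaled into the unit ball.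
    set c : ℝ := ‖x‖ + 1
    have hc : 0 < c := by positivity
    have hx : ‖(c⁻¹ : ℂ) • x‖ ≤ 1 := by
      rw [norm_smul, norm_inv, Complex.norm_real, Real.norm_of_nonneg hc.le]
      exact inv_mul_le_one_of_le₀ (by simp [c]) hc.le
    obtain ⟨r, hr, h⟩ := hL _ (rankOne_self_mem hx).1 (rankOne_self_mem hx).2
    refine ⟨c ^ 2 * r, by positivity, ?_⟩
    have hc' : (c : ℂ) ≠ 0 := by exact_mod_cast hc.ne'
    simp only [map_smul, map_smulₛₗ, _root_.smul_apply, smul_eq_mul] at h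
    simp only [map_inv₀, Complex.conj_ofReal] at h
    push_cast
    rw [← h]
    field_simp
  rw [h]
  simpa using hr

/-- Every natural transformation agrees on rank-one effects with the Born rule of some density
operator; normality, applied to an orthonormal basis, gives it unit trace. -/
theorem exists_density [TopologicalSpace.SeparableSpace H]
    (η : measurementFunctor H ⟶ probabilityFunctor.{u}) :
    ∃ ρ : DensityOperator H, ∀ x : H, ‖x‖ ≤ 1 →
      (effectProb η (rankOne ℂ x x) : ℂ) = inner ℂ (ρ.op x) x := by
  have hη := isEffectAdditive_effectProb η
  obtain ⟨L, hL⟩ := hη.exists_strongDual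
  obtain ⟨R, hR0, hR⟩ := exists_operator L fun M h0 h1 => ⟨_, hη.nonneg M h0 h1, hL M h0 h1⟩
  have hR' (x : H) (hx : ‖x‖ ≤ 1) : (effectProb η (rankOne ℂ x x) : ℂ) = inner ℂ (R x) x := by
    rw [hR, hL _ (rankOne_self_mem hx).1 (rankOne_self_mem hx).2]
  have htr : HasSum (fun i => inner ℂ (stdBasis H i) (R (stdBasis H i))) 1 := by
    have h := hasSum_effectProb η (stdBasis H) (M := 1) zero_le_one le_rfl
    rw [hη.one] at h
    have h2 := Complex.ofRealCLM.hasSum h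
    simp only [Complex.ofRealCLM_apply, Complex.ofReal_one] at h2
    refine h2.congr_fun fun i => ?_
    rw [CFC.sqrt_one]
    change _ = ((effectProb η (rankOne ℂ (stdBasis H i) (stdBasis H i)) : ℝ) : ℂ)
    rw [hR' _ ((stdBasis H).orthonormal.1 i).le]
    exact (((ContinuousLinearMap.nonneg_iff_isPositive _).1
      hR0).inner_left_eq_inner_right _ _).symm
  refine ⟨⟨R, hR0, ?_, htr.tsum_eq⟩, hR'⟩
  rw [IsTraceClass, CFC.abs_of_nonneg R hR0]
  exact htr.summable

/-- A density operator is determined by its quadratic form on the unit ball, by polarization over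
`ℂ`. -/
theorem DensityOperator.ext_of_inner {ρ σ : DensityOperator H}
    (h : ∀ x : H, ‖x‖ ≤ 1 → inner ℂ (ρ.op x) x = inner ℂ (σ.op x) x) : ρ = σ := by
  have hop : ρ.op = σ.op := by
    refine ContinuousLinearMap.coe_injective ((ext_inner_map _ _).1 fun x => ?_)
    have hc : (0 : ℝ) < ‖x‖ + 1 := by positivity
    have hc' : ((‖x‖ + 1 : ℝ) : ℂ) ≠ 0 := by exact_mod_cast hc.ne'
    have h1 := h (((‖x‖ + 1 : ℝ) : ℂ)⁻¹ • x) (by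
      rw [norm_smul, norm_inv, Complex.norm_real, Real.norm_of_nonneg hc.le]
      exact inv_mul_le_one_of_le₀ (by simp) hc.le)
    simp only [map_smul, inner_smul_left, inner_smul_right, map_inv₀, Complex.conj_ofReal,
      mul_right_inj' (inv_ne_zero hc')] at h1
    exact h1
  cases ρ
  cases σ
  cases hop
  rfl

end Density

end BornRule
end

/-- For a separable complex Hilbert space `H`, the map `ρ ↦ ρ_*` is a bijection from the density
operators on `H` to the natural transformations from the measurement functor to the probability
functor. -/
theorem theorem1 (H : Type u) [NormedAddCommGroup H] [InnerProductSpace ℂ H] [CompleteSpace H]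
    [TopologicalSpace.SeparableSpace H] :
    Function.Bijective (fun ρ : BornRule.DensityOperator H =>
      (BornRule.bornNatTrans ρ :
        BornRule.measurementFunctor.{u} H ⟶ BornRule.probabilityFunctor.{u})) := by
  refine ⟨fun ρ σ h => BornRule.DensityOperator.ext_of_inner fun x hx => ?_, fun η => ?_⟩
  · have h' : BornRule.bornNatTrans ρ = BornRule.bornNatTrans σ := h
    rw [← BornRule.effectProb_bornNatTrans ρ hx, h', BornRule.effectProb_bornNatTrans σ hx]
  · obtain ⟨ρ, hρ⟩ := BornRule.exists_density η
    refine ⟨ρ, BornRule.natTrans_ext_rankOne fun x hx => ?_⟩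
    exact_mod_cast (BornRule.effectProb_bornNatTrans ρ hx).trans (hρ x hx).symm
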